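/- **Lemma 6.2 (Support Lemma).** Let $X$ be a smooth manifold (Hausdorff, second countable, of dimension $n$) with a smooth riemannian metric, and let $\phi$ be a parallel calibration of degree $p\ge 1$ on $X$; that is, $\phi$ is a smooth closed $p$-form with $\phi(\xi)\le 1$ for all unit simple tangent $p$-vectors $\xi$, and $\nabla\phi=0$ for the Levi-Civita connection. We use the following terms. * $G(\phi)$ is the set of unit simple tangent $p$-vectors $\xi$ with $\phi(\xi)=1$. * For a smooth function $f$ on $X$, $d^\phi f$ is the $(p-1)$-form $\nabla f\,\lrcorner\,\phi$. The function $f$ is $\phi$-plurisubharmonic, $f\in PSH(X,\phi)$, if $(dd^\phi f)(\xi)\ge 0$ for all $\xi\in G(\phi)$. It is strict at $x$ if $(dd^\phi f)(\xi)>0$ for all $\xi\in G(\phi)$ at $x$. * The hull of a compact set $K\subset X$ is $\widehat K=\{x\in X:\ f(x)\le \sup_K f \text{ for all } f\in PSH(X,\phi)\}$ (with $\widehat\emptyset=\emptyset$). * $\mathrm{Core}(X)$ is the set of points $x\in X$ at which no $f\in PSH(X,\phi)$ is strict. * A current $T$ of dimension $p$ is a continuous linear functional on the smooth $p$-forms with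 compact support. It is $\phi$-positive if $T(\alpha)\ge 0$ for every smooth $p$-form $\alpha$ with compact support such that $\alpha(\xi)\ge 0$ for all $\xi\in G(\phi)$. * $\partial_\phi\partial T$ is the functional $f\mapsto T(dd^\phi f)$ on smooth functions with compact support. For an open set $U\subset X$, $\partial_\phi\partial T\le 0$ on $U$ means that it is a non-positive measure there: $T(dd^\phi f)\le 0$ for all smooth $f\ge 0$ with compact support contained in $U$. Let $T$ be a $\phi$-positive current of dimension $p$ with compact support on $X$. 1. If $K\subset X$ is compact and $\partial_\phi\partial T\le 0$ on $X\setminus\widehat K$, then $\operatorname{supp}T\subset\widehat K\cup\mathrm{Core}(X)$. 2. In particular, if $\partial_\phi\partial T\le 0$ on $X$, then $\operatorname{supp}T\subset\mathrm{Core}(X)$. -/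

import Mathlib

open Set Filter Topology
open scoped Manifold ContDiff

set_option linter.unusedSectionVars false

noncomputable section

namespace CalibratedGeometry

section
variable {E : Type*} [NormedAddCommGroup E] [NormedSpace ℝ E]
  {X : Type*} [TopologicalSpace X] [ChartedSpace E X]

variable (E X) in
/-- A (not necessarily smooth) differential `k`-form on `X`: an alternating `k`-linear form on each
tangent space. -/
abbrev Form (k : ℕ) : Type _ :=
  ∀ x : X, TangentSpace 𝓘(ℝ, E) x [⋀^Fin k]→L[ℝ] ℝ

/-- The derivative at `x` of the chart of `X` centred at `x₀`. -/
def chartDeriv (x₀ x : X) : TangentSpace 𝓘(ℝ, E) x →L[ℝ] E :=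
  mfderiv 𝓘(ℝ, E) 𝓘(ℝ, E) (extChartAt 𝓘(ℝ, E) x₀) x

/-- The derivative at `y` of the inverse of the chart of `X` centred at `x₀`. -/
def chartSymmDeriv (x₀ : X) (y : E) :
    E →L[ℝ] TangentSpace 𝓘(ℝ, E) ((extChartAt 𝓘(ℝ, E) x₀).symm y) :=
  mfderiv 𝓘(ℝ, E) 𝓘(ℝ, E) (extChartAt 𝓘(ℝ, E) x₀).symm y

/-- The coordinate expression of a form in the chart centred at `x₀`: its pullback under the inverse
of the chart. -/
def Form.inChart {k : ℕ} (α : Form E X k) (x₀ : X) (y : E) : E [⋀^Fin k]→L[ℝ] ℝ :=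
  (α ((extChartAt 𝓘(ℝ, E) x₀).symm y)).compContinuousLinearMap (chartSymmDeriv x₀ y)

/-- A form is smooth if all its coordinate expressions are. -/
def Form.IsSmooth {k : ℕ} (α : Form E X k) : Prop :=
  ∀ x₀ : X, ContDiffOn ℝ ∞ (α.inChart x₀) (extChartAt 𝓘(ℝ, E) x₀).target

/-- The exterior derivative. At `x` it is computed in the chart centred at `x`; by `inChart_d` below
it is given, for a smooth form, by the Euclidean exterior derivative in every chart. -/
def Form.d {k : ℕ} (α : Form E X k) : Form E X (k + 1) := fun x =>
  (extDeriv (α.inChart x) (extChartAt 𝓘(ℝ, E) x x)).compContinuousLinearMap (chartDeriv x x)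

/-- The support of a form. -/
def Form.supp {k : ℕ} (α : Form E X k) : Set X := closure {x | α x ≠ 0}

/-- The contraction `V ⌟ α`, i.e. `(V ⌟ α)(w₁, …, wₖ) = α(V, w₁, …, wₖ)`. -/
def Form.contract {k : ℕ} (V : ∀ x : X, TangentSpace 𝓘(ℝ, E) x) (α : Form E X (k + 1)) :
    Form E X k := fun x =>
  ContinuousAlternatingMap.curryLeft (E := E) (α x) (V x)

theorem inChart_add {k : ℕ} (α β : Form E X k) (x₀ : X) :
    (α + β).inChart x₀ = α.inChart x₀ + β.inChart x₀ := by
  funext y; ext v; rfl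

theorem inChart_smul {k : ℕ} (c : ℝ) (α : Form E X k) (x₀ : X) :
    (c • α).inChart x₀ = c • α.inChart x₀ := by
  funext y; ext v; rfl

theorem isSmooth_zero {k : ℕ} : (0 : Form E X k).IsSmooth := fun x₀ =>
  (contDiffOn_const (c := (0 : E [⋀^Fin k]→L[ℝ] ℝ))).congr fun y _ => by ext v; rfl

theorem Form.IsSmooth.add {k : ℕ} {α β : Form E X k} (hα : α.IsSmooth) (hβ : β.IsSmooth) :
    (α + β).IsSmooth := fun x₀ => by
  rw [inChart_add]; exact (hα x₀).add (hβ x₀)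

theorem Form.IsSmooth.smul {k : ℕ} {α : Form E X k} (c : ℝ) (hα : α.IsSmooth) :
    (c • α).IsSmooth := fun x₀ => by
  rw [inChart_smul]; exact contDiffOn_const.smul (hα x₀)

variable (E X) in
/-- Smooth `k`-forms with compact support. -/
def testForms (k : ℕ) : Submodule ℝ (Form E X k) where
  carrier := {α | α.IsSmooth ∧ IsCompact α.supp}
  zero_mem' := ⟨isSmooth_zero, by simp [Form.supp]⟩
  add_mem' := fun {α β} hα hβ => ⟨hα.1.add hβ.1,
    (hα.2.union hβ.2).of_isClosed_subset isClosed_closure <| by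
      rw [Form.supp, Form.supp, Form.supp, ← closure_union]
      refine closure_mono fun x hx => ?_
      by_contra h
      simp only [mem_union, mem_ofPred_eq, not_or, not_not] at h
      exact hx (by simp [h.1, h.2])⟩
  smul_mem' := fun c {α} hα => ⟨hα.1.smul c,
    hα.2.of_isClosed_subset isClosed_closure <| closure_mono fun x hx h => hx (by
      have h' : α x = 0 := h
      simp [h'])⟩

variable (E X) in
/-- Smooth functions with compact support. -/
def testFunctions : Submodule ℝ (X → ℝ) where
  carrier := {f | ContMDiff 𝓘(ℝ, E) 𝓘(ℝ, ℝ) ∞ f ∧ HasCompactSupport f}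
  zero_mem' := ⟨contMDiff_const, HasCompactSupport.zero⟩
  add_mem' := fun hf hg => ⟨hf.1.add hg.1, hf.2.add hg.2⟩
  smul_mem' := fun c _ hf => ⟨(contDiff_const_smul c).contMDiff.comp hf.1,
    hf.2.comp_left (g := fun t : ℝ => c • t) (smul_zero c)⟩

variable (E X) in
/-- A current of dimension `p` on `X`: a linear functional on the smooth `p`-forms with compact
support which is (sequentially) continuous in the usual topology: `T(αⱼ) → 0` if the `αⱼ` have their
supports in one compact set and all derivatives of their coordinate expressions tend to zero
uniformly on compact subsets of the charts. -/
structure Current (p : ℕ) where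
  toLinearMap : testForms E X p →ₗ[ℝ] ℝ
  continuous' : ∀ α : ℕ → testForms E X p,
    (∃ K : Set X, IsCompact K ∧ ∀ j, (α j).1.supp ⊆ K) →
    (∀ (x₀ : X) (C : Set E), IsCompact C → C ⊆ (extChartAt 𝓘(ℝ, E) x₀).target → ∀ m : ℕ,
      TendstoUniformlyOn (fun j => iteratedFDeriv ℝ m ((α j).1.inChart x₀)) 0 atTop C) →
    Tendsto (fun j => toLinearMap (α j)) atTop (𝓝 0)

/-- The support of a current. -/
def Current.supp {p : ℕ} (T : Current E X p) : Set X :=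
  {x | ∀ U ∈ 𝓝 x, ∃ α : testForms E X p, α.1.supp ⊆ U ∧ T.toLinearMap α ≠ 0}

/-- The current `S` of dimension `0` is `≤ 0` (a non-positive measure) on the open set `U`. -/
def NonposOn (S : testFunctions E X →ₗ[ℝ] ℝ) (U : Set X) : Prop :=
  ∀ f : testFunctions E X, (∀ x, 0 ≤ f.1 x) → tsupport f.1 ⊆ U → S f ≤ 0

theorem supp_d_subset {k : ℕ} (α : Form E X k) : α.d.supp ⊆ α.supp := by
  refine closure_minimal (fun x hx => ?_) isClosed_closure
  by_contra h
  apply hx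
  have hev : α.inChart x =ᶠ[𝓝 (extChartAt 𝓘(ℝ, E) x x)] fun _ => 0 := by
    have hc : ContinuousAt (extChartAt 𝓘(ℝ, E) x).symm (extChartAt 𝓘(ℝ, E) x x) :=
      continuousAt_extChartAt_symm x
    have hm : α.suppᶜ ∈ 𝓝 ((extChartAt 𝓘(ℝ, E) x).symm (extChartAt 𝓘(ℝ, E) x x)) := by
      rw [extChartAt_to_inv]
      exact isClosed_closure.isOpen_compl.mem_nhds h
    filter_upwards [hc hm] with y hy
    have h0 : α ((extChartAt 𝓘(ℝ, E) x).symm y) = 0 := by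
      by_contra h1
      exact hy (subset_closure h1)
    rw [Form.inChart, h0]
    rfl
  rw [Form.d, hev.extDeriv_eq]
  ext v
  simp [extDeriv, ContinuousAlternatingMap.alternatizeUncurryFin_apply]

theorem chart_target_isOpen (x₀ : X) : IsOpen (extChartAt 𝓘(ℝ, E) x₀).target :=
  isOpen_extChartAt_target x₀

section manifold
variable [IsManifold 𝓘(ℝ, E) ∞ X]

theorem chart_mdiff {x₀ x : X} (hx : x ∈ (extChartAt 𝓘(ℝ, E) x₀).source) :
    MDifferentiableAt 𝓘(ℝ, E) 𝓘(ℝ, E) (extChartAt 𝓘(ℝ, E) x₀) x :=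
  (contMDiffAt_extChartAt' (n := ∞) (by simpa using hx)).mdifferentiableAt (by simp)

theorem chartSymm_mdiff {x₀ : X} {y : E} (hy : y ∈ (extChartAt 𝓘(ℝ, E) x₀).target) :
    MDifferentiableAt 𝓘(ℝ, E) 𝓘(ℝ, E) (extChartAt 𝓘(ℝ, E) x₀).symm y :=
  ((contMDiffOn_extChartAt_symm (n := ∞) x₀).contMDiffAt
    ((chart_target_isOpen x₀).mem_nhds hy)).mdifferentiableAt (by simp)

/-- The transition map from the chart centred at `x₀` to the one centred at `x₁`. -/
def transition (x₀ x₁ : X) (y : E) : E :=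
  extChartAt 𝓘(ℝ, E) x₁ ((extChartAt 𝓘(ℝ, E) x₀).symm y)

/-- The set where the transition map is defined. -/
def overlap (x₀ x₁ : X) : Set E :=
  (extChartAt 𝓘(ℝ, E) x₀).target ∩
    (extChartAt 𝓘(ℝ, E) x₀).symm ⁻¹' (extChartAt 𝓘(ℝ, E) x₁).source

theorem overlap_isOpen (x₀ x₁ : X) : IsOpen (overlap (E := E) x₀ x₁) :=
  (continuousOn_extChartAt_symm x₀).isOpen_inter_preimage (chart_target_isOpen x₀)
    (isOpen_extChartAt_source x₁)

theorem transition_contDiffAt {x₀ x₁ : X} {y : E} (hy : y ∈ overlap x₀ x₁) :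
    ContDiffAt ℝ ∞ (transition x₀ x₁) y := by
  rw [← contMDiffAt_iff_contDiffAt]
  have h1 : ContMDiffAt 𝓘(ℝ, E) 𝓘(ℝ, E) ∞ (extChartAt 𝓘(ℝ, E) x₀).symm y :=
    (contMDiffOn_extChartAt_symm (n := ∞) x₀).contMDiffAt
      ((chart_target_isOpen x₀).mem_nhds hy.1)
  have h2 : ContMDiffAt 𝓘(ℝ, E) 𝓘(ℝ, E) ∞ (extChartAt 𝓘(ℝ, E) x₁)
      ((extChartAt 𝓘(ℝ, E) x₀).symm y) := contMDiffAt_extChartAt' (by simpa using hy.2)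
  exact h2.comp y h1

theorem fderiv_transition {x₀ x₁ : X} {y : E} (hy : y ∈ overlap x₀ x₁) :
    fderiv ℝ (transition x₀ x₁) y =
      (chartDeriv x₁ ((extChartAt 𝓘(ℝ, E) x₀).symm y)).comp (chartSymmDeriv x₀ y) := by
  rw [← mfderiv_eq_fderiv]
  exact mfderiv_comp y (chart_mdiff hy.2) (chartSymm_mdiff hy.1)

theorem chartSymmDeriv_comp_transition {x₀ x₁ : X} {y : E} (hy : y ∈ overlap x₀ x₁) :
    ((chartSymmDeriv x₁ (transition x₀ x₁ y) : E →L[ℝ] E)).comp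
      (fderiv ℝ (transition x₀ x₁) y) = (chartSymmDeriv x₀ y : E →L[ℝ] E) := by
  have hz : transition x₀ x₁ y ∈ (extChartAt 𝓘(ℝ, E) x₁).target :=
    (extChartAt 𝓘(ℝ, E) x₁).map_source hy.2
  have h := mfderiv_comp (I := 𝓘(ℝ, E)) (I' := 𝓘(ℝ, E)) (I'' := 𝓘(ℝ, E)) y (chartSymm_mdiff hz)
    ((transition_contDiffAt hy).contMDiffAt.mdifferentiableAt (by simp))
  rw [mfderiv_eq_fderiv] at h
  refine h.symm.trans ?_
  refine Filter.EventuallyEq.mfderiv_eq ?_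
  filter_upwards [(overlap_isOpen x₀ x₁).mem_nhds hy] with z hz
  exact (extChartAt 𝓘(ℝ, E) x₁).left_inv hz.2

theorem inChart_eq_pullback {k : ℕ} (α : Form E X k) {x₀ x₁ : X} {y : E}
    (hy : y ∈ overlap x₀ x₁) :
    α.inChart x₀ y = (α.inChart x₁ (transition x₀ x₁ y)).compContinuousLinearMap
      (fderiv ℝ (transition x₀ x₁) y) := by
  let α' : X → E [⋀^Fin k]→L[ℝ] ℝ := α
  have hpt : (extChartAt 𝓘(ℝ, E) x₁).symm (transition x₀ x₁ y) =
      (extChartAt 𝓘(ℝ, E) x₀).symm y := (extChartAt 𝓘(ℝ, E) x₁).left_inv hy.2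
  have h2 := chartSymmDeriv_comp_transition hy
  change (α' ((extChartAt 𝓘(ℝ, E) x₀).symm y)).compContinuousLinearMap
      (chartSymmDeriv x₀ y : E →L[ℝ] E) =
    ((α' ((extChartAt 𝓘(ℝ, E) x₁).symm (transition x₀ x₁ y))).compContinuousLinearMap
      (chartSymmDeriv x₁ (transition x₀ x₁ y) : E →L[ℝ] E)).compContinuousLinearMap
        (fderiv ℝ (transition x₀ x₁) y)
  rw [hpt, ← h2]
  rfl

/-- In every chart, `d` is the exterior derivative of the coordinate expression. -/
theorem inChart_d {k : ℕ} {α : Form E X k} (hα : α.IsSmooth) (x₀ : X) {y : E}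
    (hy : y ∈ (extChartAt 𝓘(ℝ, E) x₀).target) :
    α.d.inChart x₀ y = extDeriv (α.inChart x₀) y := by
  set x := (extChartAt 𝓘(ℝ, E) x₀).symm y with hx
  have hov : y ∈ overlap x₀ x := ⟨hy, mem_extChartAt_source x⟩
  have hev : α.inChart x₀ =ᶠ[𝓝 y] fun z => (α.inChart x (transition x₀ x z)).compContinuousLinearMap
      (fderiv ℝ (transition x₀ x) z) := by
    filter_upwards [(overlap_isOpen x₀ x).mem_nhds hov] with z hz
    exact inChart_eq_pullback α hz
  have hdiff : DifferentiableAt ℝ (α.inChart x) (transition x₀ x y) :=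
    ((hα x).contDiffAt ((chart_target_isOpen x).mem_nhds
      ((extChartAt 𝓘(ℝ, E) x).map_source hov.2))).differentiableAt (by simp)
  rw [hev.extDeriv_eq, extDeriv_pullback hdiff (transition_contDiffAt hov)
      (by rw [minSmoothness_of_isRCLikeNormedField]; exact WithTop.coe_le_coe.2 le_top),
    fderiv_transition hov]
  rfl

theorem Form.IsSmooth.d {k : ℕ} {α : Form E X k} (hα : α.IsSmooth) : α.d.IsSmooth := fun x₀ => by
  have h : ContDiffOn ℝ ∞ (fderiv ℝ (α.inChart x₀)) (extChartAt 𝓘(ℝ, E) x₀).target :=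
    (hα x₀).fderiv_of_isOpen (chart_target_isOpen x₀) (by simp)
  refine ((ContinuousAlternatingMap.alternatizeUncurryFinCLM ℝ E ℝ).contDiff.comp_contDiffOn
    h).congr fun y hy => ?_
  rw [inChart_d hα x₀ hy]
  rfl

theorem inChart_contDiffAt {k : ℕ} {α : Form E X k} (hα : α.IsSmooth) (x : X) :
    ContDiffAt ℝ ∞ (α.inChart x) (extChartAt 𝓘(ℝ, E) x x) :=
  (hα x).contDiffAt (extChartAt_target_mem_nhds x)

theorem d_add {k : ℕ} {α β : Form E X k} (hα : α.IsSmooth) (hβ : β.IsSmooth) :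
    (α + β).d = α.d + β.d := by
  funext x
  rw [Form.d, inChart_add, extDeriv_add ((inChart_contDiffAt hα x).differentiableAt (by simp))
    ((inChart_contDiffAt hβ x).differentiableAt (by simp))]
  rfl

theorem d_smul {k : ℕ} (c : ℝ) (α : Form E X k) : (c • α).d = c • α.d := by
  funext x
  rw [Form.d, inChart_smul, extDeriv_smul]
  rfl

/-- The exterior derivative on smooth forms with compact support. -/
def dTest (k : ℕ) : testForms E X k →ₗ[ℝ] testForms E X (k + 1) where
  toFun α := ⟨α.1.d, α.2.1.d, α.2.2.of_isClosed_subset isClosed_closure (supp_d_subset α.1)⟩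
  map_add' α β := Subtype.ext (d_add α.2.1 β.2.1)
  map_smul' c α := Subtype.ext (d_smul c α.1)

section metric
variable [FiniteDimensional ℝ E]

variable (E X) in
/-- A smooth riemannian metric on `X`. -/
abbrev Metric : Type _ :=
  Bundle.ContMDiffRiemannianMetric 𝓘(ℝ, E) ∞ E (fun x : X => TangentSpace 𝓘(ℝ, E) x)

theorem isInvertible_of_pos (b : E →L[ℝ] E →L[ℝ] ℝ) (hb : ∀ v, v ≠ 0 → 0 < b v v) :
    b.IsInvertible := by
  have hinj : Function.Injective b.toLinearMap := by
    refine (injective_iff_map_eq_zero b).2 fun v hv => ?_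
    by_contra h
    have h1 : 0 < b v v := hb v h
    rw [hv] at h1
    exact lt_irrefl _ h1
  have hdim : Module.finrank ℝ E = Module.finrank ℝ (E →L[ℝ] ℝ) := by
    rw [← LinearMap.toContinuousLinearMap.finrank_eq]
    exact (Subspace.dual_finrank_eq (K := ℝ) (V := E)).symm
  exact ⟨(LinearEquiv.ofInjectiveOfFinrankEq b.toLinearMap hinj hdim).toContinuousLinearEquiv, by
    ext v w; rfl⟩

theorem Metric.isInvertible (g : Metric E X) (x : X) : (g.inner x).IsInvertible :=
  isInvertible_of_pos (E := E) (g.inner x) (g.pos x)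

/-- The gradient `∇f`, the vector field dual to `df` (see `Metric.inner_grad`). -/
def Metric.grad (g : Metric E X) (f : X → ℝ) (x : X) : TangentSpace 𝓘(ℝ, E) x :=
  (g.inner x).inverse (mfderiv 𝓘(ℝ, E) 𝓘(ℝ, ℝ) f x)

theorem Metric.inner_grad_eq (g : Metric E X) (f : X → ℝ) (x : X) :
    g.inner x (g.grad f x) = mfderiv 𝓘(ℝ, E) 𝓘(ℝ, ℝ) f x := by
  exact (g.isInvertible x).self_apply_inverse _

theorem Metric.inner_grad (g : Metric E X) (f : X → ℝ) (x : X)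
    (v : TangentSpace 𝓘(ℝ, E) x) :
    g.inner x (g.grad f x) v = mfderiv 𝓘(ℝ, E) 𝓘(ℝ, ℝ) f x v := by
  exact congrArg (fun l : E →L[ℝ] ℝ => l v) (g.inner_grad_eq f x)

/-- The operator `d^φ f = ∇f ⌟ φ`. -/
def dPhi {k : ℕ} (g : Metric E X) (φ : Form E X (k + 1)) (f : X → ℝ) : Form E X k :=
  φ.contract (g.grad f)

/-- The matrix of the metric in a chart. -/
def Metric.inChart (g : Metric E X) (x₀ : X) (y : E) : E →L[ℝ] E →L[ℝ] ℝ :=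
  ContinuousLinearMap.bilinearComp (E := E) (F := E)
    (g.inner ((extChartAt 𝓘(ℝ, E) x₀).symm y)) (chartSymmDeriv x₀ y) (chartSymmDeriv x₀ y)

theorem contMDiffOn_chartSymmDeriv (x₀ : X) (u : E) :
    ContMDiffOn 𝓘(ℝ, E) (𝓘(ℝ, E).prod 𝓘(ℝ, E)) ∞ (fun y : E =>
      Bundle.TotalSpace.mk' E (E := fun x : X => TangentSpace 𝓘(ℝ, E) x)
        ((extChartAt 𝓘(ℝ, E) x₀).symm y) (chartSymmDeriv x₀ y u))
      (extChartAt 𝓘(ℝ, E) x₀).target := by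
  have h := (contMDiffOn_extChartAt_symm (I := 𝓘(ℝ, E)) (n := ∞) x₀).contMDiffOn_tangentMapWithin
    (m := ∞) (by simp) (chart_target_isOpen x₀).uniqueMDiffOn
  have hs : ContMDiff 𝓘(ℝ, E) (𝓘(ℝ, E).prod 𝓘(ℝ, E)) ∞ (fun y : E =>
      (Bundle.TotalSpace.mk' E (E := fun y : E => TangentSpace 𝓘(ℝ, E) y) y u)) := by
    exact contMDiff_vectorSpace_iff_contDiff.2 (contDiff_const (c := u))
  refine (h.comp hs.contMDiffOn fun y hy => hy).congr fun y hy => ?_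
  simp only [Function.comp, tangentMapWithin]
  rw [mfderivWithin_of_isOpen (chart_target_isOpen x₀) hy]
  rfl

theorem Metric.inChart_contDiffOn (g : Metric E X) (x₀ : X) :
    ContDiffOn ℝ ∞ (g.inChart x₀) (extChartAt 𝓘(ℝ, E) x₀).target := by
  rw [contDiffOn_clm_apply]
  intro u
  rw [contDiffOn_clm_apply]
  intro w
  have h := ContMDiffOn.clm_bundle_apply₂ (F₃ := ℝ) (E₃ := fun _ : X => ℝ)
    (g.contMDiff.comp_contMDiffOn
    (contMDiffOn_extChartAt_symm (I := 𝓘(ℝ, E)) (n := ∞) x₀))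
    (contMDiffOn_chartSymmDeriv x₀ u) (contMDiffOn_chartSymmDeriv x₀ w)
  rw [← contMDiffOn_iff_contDiffOn]
  intro y hy
  have h' := h y hy
  rw [Bundle.contMDiffWithinAt_totalSpace] at h'
  exact h'.2

theorem chartSymmDeriv_isInvertible (x₀ : X) {y : E}
    (hy : y ∈ (extChartAt 𝓘(ℝ, E) x₀).target) : (chartSymmDeriv x₀ y).IsInvertible := by
  have h := isInvertible_mfderivWithin_extChartAt_symm (I := 𝓘(ℝ, E)) hy
  simp only [modelWithCornersSelf_coe, range_id, mfderivWithin_univ] at h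
  exact h

theorem Metric.inChart_isInvertible (g : Metric E X) (x₀ : X) {y : E}
    (hy : y ∈ (extChartAt 𝓘(ℝ, E) x₀).target) : (g.inChart x₀ y).IsInvertible := by
  have hc : Function.Injective (chartSymmDeriv x₀ y) :=
    (chartSymmDeriv_isInvertible x₀ hy).injective
  refine isInvertible_of_pos _ fun v hv => ?_
  exact g.pos _ (chartSymmDeriv x₀ y v) fun h => hv (hc (h.trans (map_zero _).symm))

theorem inChart_dPhi {k : ℕ} (g : Metric E X) (φ : Form E X (k + 1)) {f : X → ℝ}
    (hf : ContMDiff 𝓘(ℝ, E) 𝓘(ℝ, ℝ) ∞ f) (x₀ : X) {y : E}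
    (hy : y ∈ (extChartAt 𝓘(ℝ, E) x₀).target) :
    (dPhi g φ f).inChart x₀ y = ContinuousAlternatingMap.curryLeft (φ.inChart x₀ y)
      ((g.inChart x₀ y).inverse (fderiv ℝ (f ∘ (extChartAt 𝓘(ℝ, E) x₀).symm) y)) := by
  set x := (extChartAt 𝓘(ℝ, E) x₀).symm y with hx
  obtain ⟨w, hw⟩ := (chartSymmDeriv_isInvertible x₀ hy).surjective (g.grad f x)
  have h1 : g.inChart x₀ y w = fderiv ℝ (f ∘ (extChartAt 𝓘(ℝ, E) x₀).symm) y := by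
    ext u
    have h2 : g.inChart x₀ y w u = g.inner x (chartSymmDeriv x₀ y w) (chartSymmDeriv x₀ y u) := rfl
    rw [h2, hw, g.inner_grad, ← mfderiv_eq_fderiv,
      mfderiv_comp (I' := 𝓘(ℝ, E)) y (hf.mdifferentiableAt (by simp)) (chartSymm_mdiff hy)]
    rfl
  rw [← h1, (g.inChart_isInvertible x₀ hy).inverse_apply_self]
  ext v
  change (φ x : E [⋀^Fin (k + 1)]→L[ℝ] ℝ) (Matrix.vecCons (g.grad f x) _) =
    (φ x : E [⋀^Fin (k + 1)]→L[ℝ] ℝ) _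
  rw [← hw]
  congr 1
  funext i
  refine Fin.cases ?_ (fun j => ?_) i <;> rfl

theorem dPhi_isSmooth {k : ℕ} (g : Metric E X) {φ : Form E X (k + 1)} (hφ : φ.IsSmooth)
    {f : X → ℝ} (hf : ContMDiff 𝓘(ℝ, E) 𝓘(ℝ, ℝ) ∞ f) : (dPhi g φ f).IsSmooth := fun x₀ => by
  have h1 : ContDiffOn ℝ ∞ (fun y => (g.inChart x₀ y).inverse)
      (extChartAt 𝓘(ℝ, E) x₀).target := fun y hy =>
    ((g.inChart_isInvertible x₀ hy).contDiffAt_map_inverse).comp_contDiffWithinAt y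
      (g.inChart_contDiffOn x₀ y hy)
  have h2 : ContDiffOn ℝ ∞ (f ∘ (extChartAt 𝓘(ℝ, E) x₀).symm) (extChartAt 𝓘(ℝ, E) x₀).target :=
    (hf.comp_contMDiffOn (contMDiffOn_extChartAt_symm (n := ∞) x₀)).contDiffOn
  have h3 := h2.fderiv_of_isOpen (m := ∞) (chart_target_isOpen x₀) (by simp)
  have h0 : ContDiff ℝ ∞ (fun a : E [⋀^Fin (k + 1)]→L[ℝ] ℝ =>
      ContinuousAlternatingMap.curryLeft a) :=
    ContinuousLinearMap.contDiff (𝕜 := ℝ) (E := E [⋀^Fin (k + 1)]→L[ℝ] ℝ)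
      (F := E →L[ℝ] E [⋀^Fin k]→L[ℝ] ℝ)
      (ContinuousAlternatingMap.curryLeftLI (𝕜 := ℝ) (E := E) (F := ℝ)
        (n := k)).toContinuousLinearMap
  have h4 := h0.comp_contDiffOn (hφ x₀)
  exact (h4.clm_apply (h1.clm_apply h3)).congr fun y hy => inChart_dPhi g φ hf x₀ hy

theorem grad_add (g : Metric E X) {f₁ f₂ : X → ℝ}
    (h₁ : ContMDiff 𝓘(ℝ, E) 𝓘(ℝ, ℝ) ∞ f₁) (h₂ : ContMDiff 𝓘(ℝ, E) 𝓘(ℝ, ℝ) ∞ f₂) (x : X) :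
    g.grad (f₁ + f₂) x = g.grad f₁ x + g.grad f₂ x := by
  have h := mfderiv_add ((h₁ x).mdifferentiableAt (by simp)) ((h₂ x).mdifferentiableAt (by simp))
  exact (congrArg (g.inner x).inverse h).trans (map_add _ _ _)

theorem grad_smul (g : Metric E X) (c : ℝ) {f : X → ℝ}
    (hf : ContMDiff 𝓘(ℝ, E) 𝓘(ℝ, ℝ) ∞ f) (x : X) : g.grad (c • f) x = c • g.grad f x := by
  have h := const_smul_mfderiv ((hf x).mdifferentiableAt (by simp)) c
  exact (congrArg (g.inner x).inverse h).trans (map_smul _ _ _)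

theorem grad_eq_zero (g : Metric E X) {f : X → ℝ} {x : X} (hx : x ∉ tsupport f) :
    g.grad f x = 0 := by
  have h : mfderiv 𝓘(ℝ, E) 𝓘(ℝ, ℝ) f x = 0 := by
    have hev : f =ᶠ[𝓝 x] fun _ => (0 : ℝ) := notMem_tsupport_iff_eventuallyEq.1 hx
    rw [hev.mfderiv_eq]
    exact mfderiv_const
  exact (congrArg (g.inner x).inverse h).trans (map_zero _)

theorem supp_dPhi_subset {k : ℕ} (g : Metric E X) (φ : Form E X (k + 1)) (f : X → ℝ) :
    (dPhi g φ f).supp ⊆ tsupport f := by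
  refine closure_minimal (fun x hx => ?_) (isClosed_tsupport f)
  by_contra h
  exact hx ((congrArg (ContinuousAlternatingMap.curryLeft (E := E) (φ x))
    (grad_eq_zero g h)).trans (map_zero _))

/-- The operator `d^φ` on smooth functions with compact support. -/
def dPhiTest {k : ℕ} (g : Metric E X) (φ : Form E X (k + 1)) (hφ : φ.IsSmooth) :
    testFunctions E X →ₗ[ℝ] testForms E X k where
  toFun f := ⟨dPhi g φ f.1, dPhi_isSmooth g hφ f.2.1,
    f.2.2.isCompact.of_isClosed_subset isClosed_closure (supp_dPhi_subset g φ f.1)⟩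
  map_add' f₁ f₂ := Subtype.ext <| funext fun x =>
    (congrArg (ContinuousAlternatingMap.curryLeft (E := E) (φ x))
      (grad_add g f₁.2.1 f₂.2.1 x)).trans (map_add _ _ _)
  map_smul' c f := Subtype.ext <| funext fun x =>
    (congrArg (ContinuousAlternatingMap.curryLeft (E := E) (φ x))
      (grad_smul g c f.2.1 x)).trans (map_smul _ _ _)

/-- The vectors `v 0, …, v (p - 1)` of `T_x X` are orthonormal. The unit simple `p`-vectors at `x`
are the `v 0 ∧ ⋯ ∧ v (p - 1)` with such `v`, and the value of a `p`-form `α` on this `p`-vector is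
`α x v`. -/
def Metric.IsOrthonormal (g : Metric E X) {p : ℕ} {x : X}
    (v : Fin p → TangentSpace 𝓘(ℝ, E) x) : Prop :=
  ∀ i j, g.inner x (v i) (v j) = if i = j then 1 else 0

/-- A calibration of degree `p` on the riemannian manifold `(X, g)`: a smooth closed `p`-form whose
value on every unit simple tangent `p`-vector is at most `1`. -/
structure Calibration (g : Metric E X) (p : ℕ) where
  form : Form E X p
  smooth : form.IsSmooth
  closed : form.d = 0
  comass_le : ∀ (x : X) (v : Fin p → TangentSpace 𝓘(ℝ, E) x), g.IsOrthonormal v → form x v ≤ 1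

/-- `cov` is the Levi-Civita connection of `g`. The vector `∇_u V` at `x` is written `cov V x u`. -/
structure IsLeviCivita (g : Metric E X)
    (cov : CovariantDerivative 𝓘(ℝ, E) E (TangentSpace 𝓘(ℝ, E) : X → Type _)) : Prop where
  torsion_free : ∀ {V W : ∀ x : X, TangentSpace 𝓘(ℝ, E) x} {x : X},
    MDiffAt (T% V) x → MDiffAt (T% W) x →
      cov W x (V x) - cov V x (W x) = VectorField.mlieBracket 𝓘(ℝ, E) V W x
  metric : ∀ {V W : ∀ x : X, TangentSpace 𝓘(ℝ, E) x} {x : X},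
    MDiffAt (T% V) x → MDiffAt (T% W) x → ∀ u : TangentSpace 𝓘(ℝ, E) x,
      mfderiv 𝓘(ℝ, E) 𝓘(ℝ, ℝ) (fun y => g.inner y (V y) (W y)) x u =
        g.inner x (cov V x u) (W x) + g.inner x (V x) (cov W x u)

namespace Calibration

variable {g : Metric E X} {p k : ℕ}

/-- The calibration is parallel, `∇φ = 0`, for the Levi-Civita connection `∇`:
`u (φ(W₁, …, W_p)) = ∑ i, φ(W₁, …, ∇_u W_i, …, W_p)` for all vector fields `W_i`. -/
def IsParallel (φ : Calibration g p) : Prop :=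
  ∃ cov : CovariantDerivative 𝓘(ℝ, E) E (TangentSpace 𝓘(ℝ, E) : X → Type _),
    IsLeviCivita g cov ∧
    ∀ (x : X) (W : Fin p → ∀ y : X, TangentSpace 𝓘(ℝ, E) y),
      (∀ i, MDiffAt (T% (W i)) x) → ∀ u : TangentSpace 𝓘(ℝ, E) x,
        mfderiv 𝓘(ℝ, E) 𝓘(ℝ, ℝ) (fun y => φ.form y (fun i => W i y)) x u =
          ∑ i, φ.form x (Function.update (fun j => W j x) i (cov (W i) x u))

/-- The orthonormal frame `v` of `p` vectors at `x` spans a `φ`-plane: the unit simple vector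
`v 0 ∧ ⋯ ∧ v (p - 1)` belongs to `G(φ)`. -/
def IsPlane (φ : Calibration g p) (x : X) (v : Fin p → TangentSpace 𝓘(ℝ, E) x) : Prop :=
  g.IsOrthonormal v ∧ φ.form x v = 1

/-- `Λ⁺(φ)`-positive `p`-forms: those with `α(ξ) ≥ 0` for all `ξ ∈ G(φ)`. -/
def IsPositiveForm (φ : Calibration g p) (α : Form E X p) : Prop :=
  ∀ (x : X) (v : Fin p → TangentSpace 𝓘(ℝ, E) x), φ.IsPlane x v → 0 ≤ α x v

/-- The `p`-form `dd^φ f` of a function `f`. -/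
def ddPhi (φ : Calibration g (k + 1)) (f : X → ℝ) : Form E X (k + 1) :=
  (dPhi g φ.form f).d

/-- The set `PSH(X, φ)` of smooth `φ`-plurisubharmonic functions (for a parallel calibration `φ`). -/
def PSH (φ : Calibration g (k + 1)) : Set (X → ℝ) :=
  {f | ContMDiff 𝓘(ℝ, E) 𝓘(ℝ, ℝ) ∞ f ∧ φ.IsPositiveForm (φ.ddPhi f)}

/-- `f` is strictly `φ`-plurisubharmonic at `x`. -/
def IsStrictAt (φ : Calibration g (k + 1)) (f : X → ℝ) (x : X) : Prop :=
  ∀ v : Fin (k + 1) → TangentSpace 𝓘(ℝ, E) x, φ.IsPlane x v → 0 < φ.ddPhi f x v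

/-- The `φ`-convex hull of `K`. The supremum is taken in `[-∞, ∞]`, so that the hull of the empty
set is empty. -/
def hull (φ : Calibration g (k + 1)) (K : Set X) : Set X :=
  {x | ∀ f ∈ φ.PSH, (f x : EReal) ≤ ⨆ y ∈ K, (f y : EReal)}

/-- The core of `X`: the points where no function in `PSH(X, φ)` is strict. -/
def core (φ : Calibration g (k + 1)) : Set X :=
  ⋂ f ∈ φ.PSH, {x | ¬ φ.IsStrictAt f x}

end Calibration

/-- `Λ₊(φ)`-positive currents: `T(α) ≥ 0` for all `Λ⁺(φ)`-positive `α` with compact support. -/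
def Current.IsPositive {g : Metric E X} {p : ℕ} (φ : Calibration g p) (T : Current E X p) : Prop :=
  ∀ α : testForms E X p, φ.IsPositiveForm α.1 → 0 ≤ T.toLinearMap α

/-- The boundary operator `(∂T)(β) = T(dβ)`. -/
def boundary {k : ℕ} (T : testForms E X (k + 1) →ₗ[ℝ] ℝ) : testForms E X k →ₗ[ℝ] ℝ :=
  T ∘ₗ dTest k

/-- The operator `(∂_φ R)(f) = R(d^φ f)`. -/
def boundaryPhi {g : Metric E X} {k : ℕ} (φ : Calibration g (k + 1))
    (R : testForms E X k →ₗ[ℝ] ℝ) : testFunctions E X →ₗ[ℝ] ℝ :=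
  R ∘ₗ dPhiTest g φ.form φ.smooth

end metric
end manifold

end

end CalibratedGeometry

end

open CalibratedGeometry

/-! Let `x` lie outside the hull and the core. Some plurisubharmonic `f` has `f x` above its
supremum on `K`, and some plurisubharmonic `h` is strict at `x`. For small `ε > 0` the function `F =
f + ε h` still separates `x` from `K` and is strict at `x`. Composing `F` with a smooth convex
increasing `χ` that vanishes up to a level between gives `u ≥ 0`, plurisubharmonic, strict at `x`,
with support off the hull (`exists_PSH_tsupport_subset`). The composition is harmless because
`dd^φ(χ ∘ F) = χ'(F) dd^φ F + χ''(F) dF ∧ d^φ F`, and on a `φ`-plane the last wedge is the squared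
length of the tangential part of `dF`. This follows from the first cousin principle
(`apply_update_eq_zero`, `wedge_dPhi_apply`). Up to cutoffs, `T(dd^φ u) ≤ 0` by the hypothesis on
`∂_φ∂T`. By compactness of the set of `φ`-planes over a small ball, every test form `α` supported
near `x` satisfies `|α| ≤ C dd^φ u` on `φ`-planes (`exists_nhds_abs_le`). Positivity of `T` then
gives `±T(α) ≤ C T(dd^φ u) ≤ 0`, so `T(α) = 0` and `x` is not in the support
(`IsPositive.notMem_supp`). -/

noncomputable section

namespace CalibratedGeometry

/-! ### Products of forms with functions and the Leibniz rule -/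

section
variable {E : Type*} [NormedAddCommGroup E] [NormedSpace ℝ E]
  {X : Type*} [TopologicalSpace X] [ChartedSpace E X] {k : ℕ}

/-- The product of a form with a function. -/
def Form.fsmul (h : X → ℝ) (α : Form E X k) : Form E X k := fun x => h x • α x

theorem inChart_fsmul (h : X → ℝ) (α : Form E X k) (x₀ : X) :
    (α.fsmul h).inChart x₀ =
      fun y => (h ∘ (extChartAt 𝓘(ℝ, E) x₀).symm) y • α.inChart x₀ y := by
  funext y; ext v; rfl

theorem Form.supp_fsmul_subset_left (h : X → ℝ) (α : Form E X k) :
    (α.fsmul h).supp ⊆ tsupport h :=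
  closure_mono fun x hx hx' => hx (by simp [Form.fsmul, hx'])

theorem Form.supp_fsmul_subset_right (h : X → ℝ) (α : Form E X k) :
    (α.fsmul h).supp ⊆ α.supp :=
  closure_mono fun x hx hx' => hx (by
    change h x • α x = 0
    rw [show α x = 0 from hx', smul_zero])

theorem Form.eq_zero_of_notMem_supp {α : Form E X k} {x : X} (hx : x ∉ α.supp) : α x = 0 := by
  by_contra h
  exact hx (subset_closure h)

section manifold
variable [IsManifold 𝓘(ℝ, E) ∞ X]

theorem contDiffOn_comp_chart_symm {h : X → ℝ} (hh : ContMDiff 𝓘(ℝ, E) 𝓘(ℝ, ℝ) ∞ h) (x₀ : X) :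
    ContDiffOn ℝ ∞ (h ∘ (extChartAt 𝓘(ℝ, E) x₀).symm) (extChartAt 𝓘(ℝ, E) x₀).target :=
  (hh.comp_contMDiffOn (contMDiffOn_extChartAt_symm (n := ∞) x₀)).contDiffOn

theorem Form.IsSmooth.fsmul {h : X → ℝ} (hh : ContMDiff 𝓘(ℝ, E) 𝓘(ℝ, ℝ) ∞ h) {α : Form E X k}
    (hα : α.IsSmooth) : (α.fsmul h).IsSmooth := fun x₀ => by
  rw [inChart_fsmul]
  exact (contDiffOn_comp_chart_symm hh x₀).smul (hα x₀)

/-- The product of a compactly supported smooth form with a smooth function. -/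
def fsmulTest (h : X → ℝ) (hh : ContMDiff 𝓘(ℝ, E) 𝓘(ℝ, ℝ) ∞ h) (α : testForms E X k) :
    testForms E X k :=
  ⟨α.1.fsmul h, α.2.1.fsmul hh,
    α.2.2.of_isClosed_subset isClosed_closure (Form.supp_fsmul_subset_right h α.1)⟩

theorem chartSymmDeriv_comp_chartDeriv (x : X) :
    (chartSymmDeriv x (extChartAt 𝓘(ℝ, E) x x) : E →L[ℝ] E).comp (chartDeriv x x : E →L[ℝ] E) =
      ContinuousLinearMap.id ℝ E := by
  have h := mfderiv_comp (I := 𝓘(ℝ, E)) (I' := 𝓘(ℝ, E)) (I'' := 𝓘(ℝ, E)) x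
    (chartSymm_mdiff (x₀ := x) (mem_extChartAt_target x)) (chart_mdiff (mem_extChartAt_source x))
  refine h.symm.trans (Eq.trans (b := mfderiv 𝓘(ℝ, E) 𝓘(ℝ, E) id x)
    (Filter.EventuallyEq.mfderiv_eq ?_) mfderiv_id)
  filter_upwards [extChartAt_source_mem_nhds (I := 𝓘(ℝ, E)) x] with z hz
  exact (extChartAt 𝓘(ℝ, E) x).left_inv hz

/-- The derivatives of a chart and of its inverse cancel, so identities computed in the chart
centred at `x` can be read back at `x`. -/
theorem inChart_self_apply (α : Form E X k) (x : X) (v : Fin k → TangentSpace 𝓘(ℝ, E) x) :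
    α.inChart x (extChartAt 𝓘(ℝ, E) x x) (fun i => chartDeriv x x (v i)) = α x v := by
  -- All tangent spaces are definitionally `E`; with a constant fibre the base point can be
  -- rewritten.
  let α' : X → E [⋀^Fin k]→L[ℝ] ℝ := α
  have h : ∀ u : E, (chartSymmDeriv x (extChartAt 𝓘(ℝ, E) x x) : E →L[ℝ] E)
      ((chartDeriv x x : E →L[ℝ] E) u) = u := fun u =>
    congrArg (fun L : E →L[ℝ] E => L u) (chartSymmDeriv_comp_chartDeriv x)
  change α' ((extChartAt 𝓘(ℝ, E) x).symm (extChartAt 𝓘(ℝ, E) x x))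
    (fun i => (chartSymmDeriv x (extChartAt 𝓘(ℝ, E) x x) : E →L[ℝ] E)
      ((chartDeriv x x : E →L[ℝ] E) (v i))) = α' x v
  rw [extChartAt_to_inv]
  congr 1
  funext i
  exact h (v i)

theorem fderiv_comp_chart_symm {h : X → ℝ} (hh : ContMDiff 𝓘(ℝ, E) 𝓘(ℝ, ℝ) ∞ h) (x : X)
    (u : TangentSpace 𝓘(ℝ, E) x) :
    fderiv ℝ (h ∘ (extChartAt 𝓘(ℝ, E) x).symm) (extChartAt 𝓘(ℝ, E) x x) (chartDeriv x x u) =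
      mvfderiv 𝓘(ℝ, E) h x u := by
  have h1 : MDifferentiableAt 𝓘(ℝ, E) 𝓘(ℝ, ℝ) (h ∘ (extChartAt 𝓘(ℝ, E) x).symm)
      (extChartAt 𝓘(ℝ, E) x x) :=
    (((contDiffOn_comp_chart_symm hh x).contDiffAt
      (extChartAt_target_mem_nhds x)).differentiableAt (by simp)).mdifferentiableAt
  have h2 := mfderiv_comp (I' := 𝓘(ℝ, E)) x h1 (chart_mdiff (mem_extChartAt_source x))
  rw [mfderiv_eq_fderiv] at h2
  have h3 : mfderiv 𝓘(ℝ, E) 𝓘(ℝ, ℝ) h x =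
      mfderiv 𝓘(ℝ, E) 𝓘(ℝ, ℝ)
        ((h ∘ (extChartAt 𝓘(ℝ, E) x).symm) ∘ extChartAt 𝓘(ℝ, E) x) x := by
    refine Filter.EventuallyEq.mfderiv_eq ?_
    filter_upwards [extChartAt_source_mem_nhds (I := 𝓘(ℝ, E)) x] with z hz
    exact congrArg h ((extChartAt 𝓘(ℝ, E) x).left_inv hz).symm
  exact (congrArg (fun L : E →L[ℝ] ℝ => L u) (h3.trans h2)).symm

/-- The Leibniz rule `d(hα) = h dα + dh ∧ α`. -/
theorem d_fsmul_apply {h : X → ℝ} (hh : ContMDiff 𝓘(ℝ, E) 𝓘(ℝ, ℝ) ∞ h) {α : Form E X k}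
    (hα : α.IsSmooth) (x : X) (v : Fin (k + 1) → TangentSpace 𝓘(ℝ, E) x) :
    (α.fsmul h).d x v = h x * α.d x v +
      ∑ i : Fin (k + 1), (-1) ^ (i : ℕ) *
        (mvfderiv 𝓘(ℝ, E) h x (v i) * α x (i.removeNth v)) := by
  set y := extChartAt 𝓘(ℝ, E) x x with hy
  have h1 : DifferentiableAt ℝ (h ∘ (extChartAt 𝓘(ℝ, E) x).symm) y :=
    ((contDiffOn_comp_chart_symm hh x).contDiffAt
      (extChartAt_target_mem_nhds x)).differentiableAt (by simp)
  have h2 : DifferentiableAt ℝ (α.inChart x) y :=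
    (inChart_contDiffAt hα x).differentiableAt (by simp)
  let w : Fin (k + 1) → E := fun i => chartDeriv x x (v i)
  change extDeriv ((α.fsmul h).inChart x) y w = h x * extDeriv (α.inChart x) y w + _
  have hhx : (h ∘ (extChartAt 𝓘(ℝ, E) x).symm) y = h x := by simp [hy]
  rw [inChart_fsmul, extDeriv, fderiv_fun_smul h1 h2, hhx,
    ContinuousAlternatingMap.alternatizeUncurryFin_add,
    ContinuousAlternatingMap.alternatizeUncurryFin_smul]
  change h x * _ + _ = _
  congr 1
  refine (ContinuousAlternatingMap.alternatizeUncurryFin_apply _ _).trans ?_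
  refine Finset.sum_congr rfl fun i _ => ?_
  rw [← fderiv_comp_chart_symm hh, ← inChart_self_apply α]
  refine (zsmul_eq_mul (α := ℝ) _ _).trans ?_
  push_cast
  rfl

end manifold

end

/-! ### First cousin principle and the chain rule for `dd^φ` -/

section
variable {E : Type*} [NormedAddCommGroup E] [NormedSpace ℝ E]
  {X : Type*} [TopologicalSpace X] [ChartedSpace E X] {k : ℕ}
  [IsManifold 𝓘(ℝ, E) ∞ X] [FiniteDimensional ℝ E] {g : Metric E X}

theorem mfderiv_real_comp {χ : ℝ → ℝ} (hχ : ContDiff ℝ ∞ χ) {f : X → ℝ}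
    (hf : ContMDiff 𝓘(ℝ, E) 𝓘(ℝ, ℝ) ∞ f) (x : X) :
    (mfderiv 𝓘(ℝ, E) 𝓘(ℝ, ℝ) (χ ∘ f) x : E →L[ℝ] ℝ) =
      deriv χ (f x) • (mfderiv 𝓘(ℝ, E) 𝓘(ℝ, ℝ) f x : E →L[ℝ] ℝ) := by
  have h := mfderiv_comp (I' := 𝓘(ℝ, ℝ)) (I'' := 𝓘(ℝ, ℝ)) x
    ((hχ.differentiable (by simp) (f x)).mdifferentiableAt)
    (hf.mdifferentiableAt (x := x) (by simp))
  rw [mfderiv_eq_fderiv] at h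
  refine h.trans ?_
  ext u
  have h' : ∀ t : ℝ, fderiv ℝ χ (f x) t = deriv χ (f x) * t := fun t => by
    rw [fderiv_eq_smul_deriv, smul_eq_mul, mul_comm]
  exact h' _

theorem dPhi_real_comp (φ : Form E X (k + 1)) {χ : ℝ → ℝ} (hχ : ContDiff ℝ ∞ χ) {f : X → ℝ}
    (hf : ContMDiff 𝓘(ℝ, E) 𝓘(ℝ, ℝ) ∞ f) :
    dPhi g φ (χ ∘ f) = (dPhi g φ f).fsmul (deriv χ ∘ f) := by
  funext x
  have h : g.grad (χ ∘ f) x = deriv χ (f x) • g.grad f x :=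
    (congrArg (g.inner x).inverse (mfderiv_real_comp hχ hf x)).trans (map_smul _ _ _)
  exact (congrArg (ContinuousAlternatingMap.curryLeft (E := E) (φ x)) h).trans (map_smul _ _ _)

namespace Calibration

/-- The first cousin principle: a calibration vanishes on the first cousins of a `φ`-plane. -/
theorem apply_update_eq_zero {p : ℕ} (φ : Calibration g p) {x : X}
    {v : Fin p → TangentSpace 𝓘(ℝ, E) x} (hv : φ.IsPlane x v) (i : Fin p)
    {w : TangentSpace 𝓘(ℝ, E) x} (hw : ∀ j, g.inner x w (v j) = 0) :
    φ.form x (Function.update v i w) = 0 := by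
  set a : ℝ := φ.form x (Function.update v i w) with ha
  set q : ℝ := g.inner x w w with hq
  have hq0 : 0 ≤ q := by
    by_cases h : w = 0
    · rw [hq, h]; simp
    · exact (g.pos x w h).le
  have key : ∀ t : ℝ, 1 + t * a ≤ √(1 + t ^ 2 * q) := by
    intro t
    set s := √(1 + t ^ 2 * q) with hs
    have hpos : 0 < 1 + t ^ 2 * q := by positivity
    have hs0 : 0 < s := Real.sqrt_pos.2 hpos
    have hss : s * s = 1 + t ^ 2 * q := Real.mul_self_sqrt hpos.le
    have horth : g.IsOrthonormal (Function.update v i (s⁻¹ • (v i + t • w))) := by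
      intro j l
      have hwj : ∀ j, g.inner x (v j) w = 0 := fun j => (g.symm x _ _).trans (hw j)
      by_cases hj : j = i <;> by_cases hl : l = i
      · subst hj; subst hl
        have h1 := hv.1 l l
        rw [if_pos rfl] at h1
        simp only [Function.update_self, map_smul, map_add, smul_apply,
          add_apply, smul_eq_mul, h1, hw, hwj, ← hq, if_true]
        field_simp
        linarith
      · subst hj
        have h1 := hv.1 j l
        rw [if_neg (Ne.symm hl)] at h1
        simp [Function.update_of_ne hl, h1, hw, Ne.symm hl]
      · subst hl
        have h1 := hv.1 j l
        rw [if_neg hj] at h1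
        simp [h1, hwj, hj]
      · rw [Function.update_of_ne hj, Function.update_of_ne hl]
        exact hv.1 j l
    have h := φ.comass_le x _ horth
    rw [ContinuousAlternatingMap.map_update_smul, ContinuousAlternatingMap.map_update_add,
      ContinuousAlternatingMap.map_update_smul, Function.update_eq_self, hv.2, ← ha, smul_eq_mul,
      smul_eq_mul, inv_mul_le_iff₀ hs0, mul_one] at h
    exact h
  by_contra hne
  -- Take `t = a / (1 + q)` and `√(1 + s) ≤ 1 + s / 2`: the linear gain exceeds the quadratic loss
  -- unless `a = 0`. The denominator `1 + q` also covers `q = 0`.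
  have h1 : 1 + a / (1 + q) * a ≤ 1 + (a / (1 + q)) ^ 2 * q / 2 := by
    refine (key _).trans (Real.sqrt_le_iff.2 ⟨by positivity, ?_⟩)
    nlinarith [sq_nonneg ((a / (1 + q)) ^ 2 * q)]
  have h2 : 0 < a ^ 2 := by positivity
  have h3 : a / (1 + q) * a - (a / (1 + q)) ^ 2 * q / 2 = a ^ 2 * (2 + q) / (2 * (1 + q) ^ 2) := by
    field_simp
    ring
  have h4 : 0 < a ^ 2 * (2 + q) / (2 * (1 + q) ^ 2) := by positivity
  linarith

/-- Split `w` into its projection to the plane and a normal part. The normal part is a first cousin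
and contributes nothing; of the projection only the `v i` component survives, the others repeating a
vector of the frame. -/
theorem apply_update (φ : Calibration g k) {x : X}
    {v : Fin k → TangentSpace 𝓘(ℝ, E) x} (hv : φ.IsPlane x v) (i : Fin k)
    (w : TangentSpace 𝓘(ℝ, E) x) :
    φ.form x (Function.update v i w) = g.inner x w (v i) := by
  set c : Fin k → ℝ := fun j => g.inner x w (v j) with hc
  have h0 := φ.apply_update_eq_zero hv i (w := w - ∑ j, c j • v j) fun l => by
    have hs : g.inner x (∑ j, c j • v j) (v l) = c l := by
      rw [map_sum, sum_apply, Finset.sum_eq_single l]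
      · simp [hv.1 l l]
      · intro j _ hj
        simp [hv.1 j l, hj]
      · simp
    rw [map_sub, sub_apply, hs, sub_self]
  rw [ContinuousAlternatingMap.map_update_sub, sub_eq_zero] at h0
  have hsum := (φ.form x).toMultilinearMap.map_update_sum Finset.univ i (fun j => c j • v j) v
  rw [h0]
  refine hsum.trans ?_
  change ∑ j, φ.form x (Function.update v i (c j • v j)) = _
  rw [Finset.sum_eq_single i]
  · rw [ContinuousAlternatingMap.map_update_smul, Function.update_eq_self, hv.2]
    simp [hc]
  · intro j _ hj
    have h := (φ.form x).toAlternatingMap.map_update_self v hj.symm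
    rw [ContinuousAlternatingMap.map_update_smul]
    exact (congrArg (c j • ·) h).trans (smul_zero _)
  · simp

/-- On a `φ`-plane, `dh ∧ d^φ f` is the inner product of the tangential parts of `dh` and `df`. -/
theorem wedge_dPhi_apply (φ : Calibration g (k + 1)) (f : X → ℝ) (l : E → ℝ) {x : X}
    {v : Fin (k + 1) → TangentSpace 𝓘(ℝ, E) x} (hv : φ.IsPlane x v) :
    ∑ i : Fin (k + 1), (-1) ^ (i : ℕ) * (l (v i) * dPhi g φ.form f x (i.removeNth v)) =
      ∑ i, l (v i) * mvfderiv 𝓘(ℝ, E) f x (v i) := by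
  refine Finset.sum_congr rfl fun i _ => ?_
  have h1 := φ.apply_update hv i (g.grad f x)
  rw [g.inner_grad] at h1
  -- Moving the gradient from the front to slot `i` costs the sign `(-1) ^ i`.
  have h2 : (-1) ^ (i : ℕ) * dPhi g φ.form f x (i.removeNth v) =
      φ.form x (Function.update v i (g.grad f x)) := by
    have h3 := (φ.form x).toAlternatingMap.map_insertNth i (g.grad f x) (i.removeNth v)
    rw [Fin.insertNth_removeNth] at h3
    exact (h3.trans (by simp; rfl)).symm
  have h4 : mvfderiv 𝓘(ℝ, E) f x (v i) = mfderiv 𝓘(ℝ, E) 𝓘(ℝ, ℝ) f x (v i) := rfl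
  rw [h4, ← h1, ← h2]
  ring

/-- Both coefficients are nonnegative when `χ` is increasing and convex, so such `χ` preserve
plurisubharmonicity. -/
theorem ddPhi_real_comp_apply (φ : Calibration g (k + 1)) {χ : ℝ → ℝ} (hχ : ContDiff ℝ ∞ χ)
    {f : X → ℝ} (hf : ContMDiff 𝓘(ℝ, E) 𝓘(ℝ, ℝ) ∞ f) {x : X}
    {v : Fin (k + 1) → TangentSpace 𝓘(ℝ, E) x} (hv : φ.IsPlane x v) :
    φ.ddPhi (χ ∘ f) x v = deriv χ (f x) * φ.ddPhi f x v +
      deriv (deriv χ) (f x) * ∑ i, mvfderiv 𝓘(ℝ, E) f x (v i) ^ 2 := by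
  have hχ' : ContDiff ℝ ∞ (deriv χ) := ((contDiff_infty_iff_deriv).1 hχ).2
  have hcomp : ContMDiff 𝓘(ℝ, E) 𝓘(ℝ, ℝ) ∞ (deriv χ ∘ f) := hχ'.contMDiff.comp hf
  rw [ddPhi, dPhi_real_comp φ.form hχ hf,
    d_fsmul_apply hcomp (dPhi_isSmooth g φ.smooth hf),
    φ.wedge_dPhi_apply f (fun u => mvfderiv 𝓘(ℝ, E) (deriv χ ∘ f) x u) hv, Finset.mul_sum]
  congr 1
  refine Finset.sum_congr rfl fun i _ => ?_
  have h : mvfderiv 𝓘(ℝ, E) (deriv χ ∘ f) x (v i) =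
      deriv (deriv χ) (f x) * mvfderiv 𝓘(ℝ, E) f x (v i) :=
    congrArg (fun L : E →L[ℝ] ℝ => L (v i)) (mfderiv_real_comp hχ' hf x)
  rw [h]
  ring

theorem ddPhi_add (φ : Calibration g (k + 1)) {f₁ f₂ : X → ℝ}
    (h₁ : ContMDiff 𝓘(ℝ, E) 𝓘(ℝ, ℝ) ∞ f₁) (h₂ : ContMDiff 𝓘(ℝ, E) 𝓘(ℝ, ℝ) ∞ f₂) :
    φ.ddPhi (f₁ + f₂) = φ.ddPhi f₁ + φ.ddPhi f₂ := by
  rw [ddPhi, ddPhi, ddPhi,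
    ← d_add (dPhi_isSmooth g φ.smooth h₁) (dPhi_isSmooth g φ.smooth h₂)]
  congr 1
  funext x
  exact (congrArg (ContinuousAlternatingMap.curryLeft (E := E) (φ.form x))
    (grad_add g h₁ h₂ x)).trans (map_add _ _ _)

theorem ddPhi_smul (φ : Calibration g (k + 1)) (c : ℝ) {f : X → ℝ}
    (hf : ContMDiff 𝓘(ℝ, E) 𝓘(ℝ, ℝ) ∞ f) : φ.ddPhi (c • f) = c • φ.ddPhi f := by
  rw [ddPhi, ddPhi, ← d_smul]
  congr 1
  funext x
  exact (congrArg (ContinuousAlternatingMap.curryLeft (E := E) (φ.form x))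
    (grad_smul g c hf x)).trans (map_smul _ _ _)

theorem add_smul_mem_PSH {φ : Calibration g (k + 1)} {f h : X → ℝ} (hf : f ∈ φ.PSH)
    (hh : h ∈ φ.PSH) {c : ℝ} (hc : 0 ≤ c) : f + c • h ∈ φ.PSH := by
  have hs : ContMDiff 𝓘(ℝ, E) 𝓘(ℝ, ℝ) ∞ (c • h) := (contDiff_const_smul c).contMDiff.comp hh.1
  refine ⟨hf.1.add hs, fun x v hv => ?_⟩
  rw [φ.ddPhi_add hf.1 hs, φ.ddPhi_smul c hh.1]
  exact add_nonneg (hf.2 x v hv) (mul_nonneg hc (hh.2 x v hv))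

/-- Any positive multiple of `h` transmits strictness, so it can be taken small enough not to spoil
estimates on `f`. -/
theorem IsStrictAt.add_smul {φ : Calibration g (k + 1)} {f h : X → ℝ} {x : X} (hf : f ∈ φ.PSH)
    (hh : h ∈ φ.PSH) {c : ℝ} (hc : 0 < c) (hx : φ.IsStrictAt h x) :
    φ.IsStrictAt (f + c • h) x := by
  have hs : ContMDiff 𝓘(ℝ, E) 𝓘(ℝ, ℝ) ∞ (c • h) := (contDiff_const_smul c).contMDiff.comp hh.1
  intro v hv
  rw [φ.ddPhi_add hf.1 hs, φ.ddPhi_smul c hh.1]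
  exact add_pos_of_nonneg_of_pos (hf.2 x v hv) (mul_pos hc (hx v hv))

end Calibration

end

/-! ### Supports of currents, compactness of `φ`-planes, local domination -/

section
variable {E : Type*} [NormedAddCommGroup E] [NormedSpace ℝ E]
  {X : Type*} [TopologicalSpace X] [ChartedSpace E X] {k p : ℕ}
  [IsManifold 𝓘(ℝ, E) ∞ X] [FiniteDimensional ℝ E] {g : Metric E X}

/-- A partition of unity on the compact support of `α` splits `α` into finitely many pieces, each in
an open set where `T` vanishes. -/
theorem Current.apply_eq_zero_of_disjoint [T2Space X] [SigmaCompactSpace X] (T : Current E X p)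
    {α : testForms E X p} (h : Disjoint α.1.supp T.supp) : T.toLinearMap α = 0 := by
  have hU : ∀ x ∈ α.1.supp, ∃ U ∈ 𝓝 x, ∀ β : testForms E X p, β.1.supp ⊆ U →
      T.toLinearMap β = 0 := fun x hx => by
    have hx' : x ∉ T.supp := disjoint_left.1 h hx
    simp only [Current.supp, mem_ofPred_eq, not_forall, not_exists, not_and, not_not] at hx'
    obtain ⟨U, hU, h⟩ := hx'
    exact ⟨U, hU, h⟩
  choose! U hU hT using hU
  obtain ⟨t, ht, hcov⟩ := α.2.2.elim_nhds_subcover (fun x => interior (U x))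
    fun x hx => interior_mem_nhds.2 (hU x hx)
  obtain ⟨ρ, hρ⟩ := SmoothPartitionOfUnity.exists_isSubordinate 𝓘(ℝ, E)
    (isClosed_closure : IsClosed α.1.supp) (fun i : t => interior (U i))
    (fun _ => isOpen_interior) (by rwa [iUnion_subtype (fun x => x ∈ t) fun i => interior (U i)])
  have hsum : α = ∑ i : t, fsmulTest (ρ i) (ρ i).contMDiff α := by
    refine Subtype.ext (funext fun x => ?_)
    have h1 : (∑ i : t, fsmulTest (ρ i) (ρ i).contMDiff α).1 x = (∑ i : t, ρ i x) • α.1 x := by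
      rw [Finset.sum_smul, ← Submodule.subtype_apply, map_sum, Finset.sum_apply]
      rfl
    rw [h1]
    by_cases hx : x ∈ α.1.supp
    · rw [← finsum_eq_sum_of_fintype, ρ.sum_eq_one hx, one_smul]
    · rw [Form.eq_zero_of_notMem_supp hx, smul_zero]
  rw [hsum, map_sum]
  exact Finset.sum_eq_zero fun i _ => hT i (ht i i.2) _
    ((Form.supp_fsmul_subset_left _ _).trans ((hρ i).trans interior_subset))

namespace Calibration

/-- The orthonormal frames of the `φ`-planes over `B`, in the chart centred at `x`. -/
def planesInChart (φ : Calibration g p) (x : X) (B : Set E) : Set (E × (Fin p → E)) :=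
  {z | z.1 ∈ B ∧ (∀ i j, g.inChart x z.1 (z.2 i) (z.2 j) = if i = j then 1 else 0) ∧
    φ.form.inChart x z.1 z.2 = 1}

theorem continuousOn_inChart_apply {α : Form E X p} (hα : α.IsSmooth) (x : X)
    {S : Set (E × (Fin p → E))} (hS : ∀ z ∈ S, z.1 ∈ (extChartAt 𝓘(ℝ, E) x).target) :
    ContinuousOn (fun z : E × (Fin p → E) => α.inChart x z.1 z.2) S :=
  ((hα x).continuousOn.comp continuousOn_fst hS).eval continuousOn_snd

theorem continuousOn_metric_inChart_apply (g : Metric E X) (x : X) {Z : Type*} [TopologicalSpace Z]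
    {S : Set Z} {y u w : Z → E} (hy : ContinuousOn y S) (hu : ContinuousOn u S)
    (hw : ContinuousOn w S)
    (hS : ∀ z ∈ S, y z ∈ (extChartAt 𝓘(ℝ, E) x).target) :
    ContinuousOn (fun z => g.inChart x (y z) (u z) (w z)) S :=
  ((((g.inChart_contDiffOn x).continuousOn.comp hy hS).clm_apply hu).clm_apply hw)

/-- The defining equations are closed, and over a compact set the metric is bounded below on
Euclidean unit vectors, which bounds orthonormal frames. -/
theorem isCompact_planesInChart (φ : Calibration g p) (x : X) {B : Set E} (hB : IsCompact B)
    (hBt : B ⊆ (extChartAt 𝓘(ℝ, E) x).target) : IsCompact (φ.planesInChart x B) := by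
  have := FiniteDimensional.proper ℝ E
  have hpos : ∀ y ∈ B, ∀ u : E, u ≠ 0 → 0 < g.inChart x y u u := fun y hy u hu =>
    g.pos _ (chartSymmDeriv x y u) fun h => hu
      ((chartSymmDeriv_isInvertible x (hBt hy)).injective (h.trans (map_zero _).symm))
  obtain ⟨M, hM⟩ := (hB.prod (isCompact_sphere (0 : E) 1)).exists_bound_of_continuousOn
    (f := fun z => (g.inChart x z.1 z.2 z.2)⁻¹)
    ((continuousOn_metric_inChart_apply g x continuousOn_fst continuousOn_snd continuousOn_snd
      fun z hz => hBt hz.1).inv₀ fun z hz =>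
        (hpos z.1 hz.1 z.2 (ne_zero_of_mem_unit_sphere ⟨z.2, hz.2⟩)).ne')
  -- Rescaling to the unit sphere gives `‖u‖ ^ 2 ≤ M`; the bound `M + 1` avoids a square root.
  have hbound : ∀ y ∈ B, ∀ u : E, g.inChart x y u u = 1 → ‖u‖ ≤ M + 1 := by
    intro y hy u hu
    have hu0 : u ≠ 0 := by rintro rfl; simp at hu
    have hn : 0 < ‖u‖ := norm_pos_iff.2 hu0
    have h1 := hM (y, ‖u‖⁻¹ • u) ⟨hy, by simp [norm_smul, hn.ne']⟩
    have h2 : (g.inChart x y (‖u‖⁻¹ • u) (‖u‖⁻¹ • u))⁻¹ = ‖u‖ ^ 2 := by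
      simp [hu, pow_two]
    simp only [h2, norm_pow, norm_norm] at h1
    nlinarith [sq_nonneg (‖u‖ - 1)]
  set K : Set (E × (Fin p → E)) := B ×ˢ univ.pi fun _ => Metric.closedBall 0 (M + 1) with hK
  have hKc : IsCompact K := hB.prod (isCompact_univ_pi fun _ => isCompact_closedBall _ _)
  have hKt : ∀ z ∈ K, z.1 ∈ (extChartAt 𝓘(ℝ, E) x).target := fun z hz => hBt hz.1
  have hF : ContinuousOn (fun z : E × (Fin p → E) =>
      ((fun i j => g.inChart x z.1 (z.2 i) (z.2 j) : Fin p → Fin p → ℝ),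
        φ.form.inChart x z.1 z.2)) K := by
    refine ContinuousOn.prodMk (continuousOn_pi.2 fun i => continuousOn_pi.2 fun j => ?_)
      (continuousOn_inChart_apply φ.smooth x hKt)
    exact continuousOn_metric_inChart_apply g x continuousOn_fst
      ((continuous_apply i).comp continuous_snd).continuousOn
      ((continuous_apply j).comp continuous_snd).continuousOn hKt
  refine hKc.of_isClosed_subset (?_ : IsClosed (φ.planesInChart x B)) fun z hz => ⟨hz.1, ?_⟩
  · convert hF.preimage_isClosed_of_isClosed hKc.isClosed
      (isClosed_singleton (x := ((fun i j => if i = j then 1 else 0, 1) :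
        (Fin p → Fin p → ℝ) × ℝ))) using 1
    ext z
    simp only [planesInChart, mem_ofPred_eq, mem_inter_iff, mem_preimage, mem_singleton_iff,
      Prod.mk.injEq, funext_iff]
    constructor
    · rintro ⟨h1, h2, h3⟩
      exact ⟨⟨h1, fun i _ => by simpa using hbound _ h1 _ (by simpa using h2 i i)⟩, h2, h3⟩
    · rintro ⟨h1, h2, h3⟩
      exact ⟨h1.1, h2, h3⟩
  · exact fun i _ => by simpa using hbound _ hz.1 _ (by simpa using hz.2.1 i i)

/-- A smooth form that is positive on the `φ`-planes at `x` dominates, near `x`, every smooth form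
on `φ`-planes. -/
theorem exists_nhds_abs_le (φ : Calibration g p) {β : Form E X p} (hβ : β.IsSmooth) {x : X}
    (hx : ∀ v, φ.IsPlane x v → 0 < β x v) :
    ∃ N ∈ 𝓝 x, IsCompact N ∧ ∀ α : Form E X p, α.IsSmooth →
      ∃ C, ∀ y ∈ N, ∀ v, φ.IsPlane y v → |α y v| ≤ C * β y v := by
  have := FiniteDimensional.proper ℝ E
  set y₀ := extChartAt 𝓘(ℝ, E) x x with hy₀
  have hx' : ∀ v, φ.IsPlane ((extChartAt 𝓘(ℝ, E) x).symm y₀) v →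
      0 < β ((extChartAt 𝓘(ℝ, E) x).symm y₀) v := by
    rw [hy₀, extChartAt_to_inv]; exact hx
  obtain ⟨r, hr, hrt⟩ := Metric.nhds_basis_closedBall.mem_iff.1
    (extChartAt_target_mem_nhds (I := 𝓘(ℝ, E)) x)
  have hP := φ.isCompact_planesInChart x (isCompact_closedBall y₀ r) hrt
  have hβc := continuousOn_inChart_apply hβ x (S := φ.planesInChart x (Metric.closedBall y₀ r))
    fun z hz => hrt hz.1
  -- The bad planes, where `β ≤ 0`, form a compact set whose projection misses `y₀`; a smaller ball
  -- avoids it.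
  set Q := φ.planesInChart x (Metric.closedBall y₀ r) ∩
    (fun z : E × (Fin p → E) => β.inChart x z.1 z.2) ⁻¹' Iic 0 with hQ
  have hQc : IsCompact Q := hP.of_isClosed_subset
    (hβc.preimage_isClosed_of_isClosed hP.isClosed isClosed_Iic) inter_subset_left
  have hy₀Q : y₀ ∉ Prod.fst '' Q := by
    rintro ⟨⟨y, w⟩, ⟨hw, hneg⟩, hy⟩
    obtain rfl : y = y₀ := hy
    exact not_lt.2 hneg (hx' (fun i => chartSymmDeriv x y₀ (w i)) hw.2)
  obtain ⟨r', hr', hrQ⟩ := Metric.nhds_basis_closedBall.mem_iff.1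
    ((hQc.image continuous_fst).isClosed.isOpen_compl.mem_nhds hy₀Q)
  set B := Metric.closedBall y₀ (min r r') with hB
  have hBt : B ⊆ (extChartAt 𝓘(ℝ, E) x).target :=
    (Metric.closedBall_subset_closedBall (min_le_left _ _)).trans hrt
  have hβpos : ∀ z ∈ φ.planesInChart x B, 0 < β.inChart x z.1 z.2 := by
    intro z hz
    by_contra hneg
    exact hrQ (Metric.closedBall_subset_closedBall (min_le_right _ _) hz.1)
      ⟨z, ⟨⟨Metric.closedBall_subset_closedBall (min_le_left _ _) hz.1, hz.2⟩, not_lt.1 hneg⟩, rfl⟩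
  refine ⟨(extChartAt 𝓘(ℝ, E) x).symm '' B, ?_, (isCompact_closedBall _ _).image_of_continuousOn
    ((continuousOn_extChartAt_symm x).mono hBt), fun α hα => ?_⟩
  · filter_upwards [extChartAt_source_mem_nhds (I := 𝓘(ℝ, E)) x,
      (continuousAt_extChartAt (I := 𝓘(ℝ, E)) x).preimage_mem_nhds
        (Metric.closedBall_mem_nhds y₀ (lt_min hr hr'))] with z hz hzB
    exact ⟨_, hzB, (extChartAt 𝓘(ℝ, E) x).left_inv hz⟩
  · have hBt' : ∀ z ∈ φ.planesInChart x B, z.1 ∈ (extChartAt 𝓘(ℝ, E) x).target :=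
      fun z hz => hBt hz.1
    -- `C` bounds the continuous quotient `α / β` on the compact set of planes. It depends on `α`,
    -- while the neighbourhood does not.
    obtain ⟨C, hC⟩ := (φ.isCompact_planesInChart x (isCompact_closedBall _ _)
      hBt).exists_bound_of_continuousOn (f := fun z => α.inChart x z.1 z.2 / β.inChart x z.1 z.2)
        ((continuousOn_inChart_apply hα x hBt').div (continuousOn_inChart_apply hβ x hBt')
          fun z hz => (hβpos z hz).ne')
    refine ⟨C, ?_⟩
    rintro _ ⟨y, hy, rfl⟩ v hv
    have hsurj := (chartSymmDeriv_isInvertible x (hBt hy)).surjective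
    choose w hw using fun i => hsurj (v i)
    obtain rfl : (fun i => chartSymmDeriv x y (w i)) = v := funext hw
    have hz : (y, w) ∈ φ.planesInChart x B := ⟨hy, hv⟩
    have h := hC _ hz
    rw [Real.norm_eq_abs, abs_div, abs_of_pos (hβpos _ hz), div_le_iff₀ (hβpos _ hz)] at h
    exact h

end Calibration

end
end CalibratedGeometry

end

/-! ### A convex cutoff on the line -/

noncomputable section

/-- A smooth convex function that vanishes on `(-∞, c]` and is strictly increasing on `[c, ∞)`. -/
theorem exists_contDiff_convex_cutoff (c : ℝ) : ∃ χ : ℝ → ℝ, ContDiff ℝ ∞ χ ∧ (∀ t, 0 ≤ χ t) ∧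
    (∀ t ≤ c, χ t = 0) ∧ (∀ t, 0 ≤ deriv χ t) ∧ (∀ t, c < t → 0 < deriv χ t) ∧
    ∀ t, 0 ≤ deriv (deriv χ) t := by
  -- `ψ` is smooth, monotone, zero up to `c` and positive beyond; its integral from `c` is the
  -- required function.
  set ψ : ℝ → ℝ := fun s => expNegInvGlue (s - c) with hψ
  have hψs : ContDiff ℝ ∞ ψ := expNegInvGlue.contDiff.comp (contDiff_id.sub contDiff_const)
  have hd : ∀ t, HasDerivAt (fun t => ∫ s in c..t, ψ s) (ψ t) t := fun t =>
    (hψs.continuous.integral_hasStrictDerivAt c t).hasDerivAt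
  have hderiv : deriv (fun t => ∫ s in c..t, ψ s) = ψ := funext fun t => (hd t).deriv
  have hz : ∀ t ≤ c, ∫ s in c..t, ψ s = 0 := fun t ht => by
    rw [intervalIntegral.integral_congr (g := fun _ => 0), intervalIntegral.integral_zero]
    intro s hs
    rw [uIcc_of_ge ht] at hs
    exact expNegInvGlue.zero_of_nonpos (by linarith [hs.2])
  have hnonneg : ∀ t, 0 ≤ ψ t := fun t => expNegInvGlue.nonneg _
  refine ⟨fun t => ∫ s in c..t, ψ s, ?_, fun t => ?_, hz, ?_, fun t ht => ?_, fun t => ?_⟩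
  · rw [contDiff_infty_iff_deriv, hderiv]
    exact ⟨fun t => (hd t).differentiableAt, hψs⟩
  · rcases le_total t c with h | h
    · exact (hz t h).ge
    · exact intervalIntegral.integral_nonneg h fun s _ => hnonneg s
  · rw [hderiv]; exact hnonneg
  · rw [hderiv]; exact expNegInvGlue.pos_of_pos (sub_pos.2 ht)
  · rw [hderiv]
    exact (expNegInvGlue.monotone.comp fun s t h => sub_le_sub_right h c).deriv_nonneg

namespace CalibratedGeometry

/-! ### The separating function and the vanishing of `T` -/

section
variable {E : Type*} [NormedAddCommGroup E] [NormedSpace ℝ E]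
  {X : Type*} [TopologicalSpace X] [ChartedSpace E X] {k p : ℕ}

/-- Locality of `d`; through `ddPhi_congr` it makes a cutoff invisible to `dd^φ` where the cutoff is
locally `1`. -/
theorem d_congr {α β : Form E X k} {x : X} (h : ∀ᶠ y in 𝓝 x, α y = β y) : α.d x = β.d x := by
  have hev : α.inChart x =ᶠ[𝓝 (extChartAt 𝓘(ℝ, E) x x)] β.inChart x := by
    have hc := continuousAt_extChartAt_symm (I := 𝓘(ℝ, E)) x
    rw [ContinuousAt, extChartAt_to_inv] at hc
    filter_upwards [hc.eventually h] with y hy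
    rw [Form.inChart, hy]
    rfl
  rw [Form.d, Form.d, hev.extDeriv_eq]

variable [IsManifold 𝓘(ℝ, E) ∞ X] [FiniteDimensional ℝ E] {g : Metric E X}

theorem Calibration.ddPhi_congr (φ : Calibration g (k + 1)) {f₁ f₂ : X → ℝ} {x : X}
    (h : f₁ =ᶠ[𝓝 x] f₂) : φ.ddPhi f₁ x = φ.ddPhi f₂ x := by
  refine d_congr ?_
  filter_upwards [eventually_eventually_nhds.2 h] with y hy
  have h1 : f₁ =ᶠ[𝓝 y] f₂ := hy
  have h2 : g.grad f₁ y = g.grad f₂ y := congrArg (g.inner y).inverse h1.mfderiv_eq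
  exact congrArg (ContinuousAlternatingMap.curryLeft (E := E) (φ.form y)) h2

theorem exists_cutoff [T2Space X] [SigmaCompactSpace X] {K : Set X} (hK : IsCompact K) :
    ∃ η : X → ℝ, ContMDiff 𝓘(ℝ, E) 𝓘(ℝ, ℝ) ∞ η ∧ HasCompactSupport η ∧
      (∀ᶠ x in 𝓝ˢ K, η x = 1) ∧ ∀ x, 0 ≤ η x := by
  have : LocallyCompactSpace X := ChartedSpace.locallyCompactSpace E X
  obtain ⟨L, hL, hKL⟩ := exists_compact_superset hK
  obtain ⟨η, h1, h0, hη⟩ := exists_contMDiffMap_one_nhds_of_subset_interior (n := ⊤) 𝓘(ℝ, E)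
    hK.isClosed hKL
  exact ⟨η, η.contMDiff, HasCompactSupport.intro hL h0, h1, fun x => (hη x).1⟩

namespace Calibration

/-- A point outside the hull and the core admits a nonnegative plurisubharmonic function that is
strict there and vanishes near the hull. -/
theorem exists_PSH_tsupport_subset (φ : Calibration g (k + 1)) {K : Set X} (hK : IsCompact K)
    {x : X} (hxK : x ∉ φ.hull K) (hxc : x ∉ φ.core) :
    ∃ u ∈ φ.PSH, (∀ y, 0 ≤ u y) ∧ φ.IsStrictAt u x ∧ tsupport u ⊆ (φ.hull K)ᶜ := by
  obtain ⟨f, hf, hfx⟩ : ∃ f ∈ φ.PSH, ⨆ y ∈ K, (f y : EReal) < (f x : EReal) := by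
    simpa [hull] using hxK
  obtain ⟨h, hh, hhx⟩ : ∃ h ∈ φ.PSH, φ.IsStrictAt h x := by
    simpa [core] using hxc
  -- A real level `a` replaces the supremum, which is `-∞` for empty `K`.
  obtain ⟨a, hKa, hax⟩ := EReal.lt_iff_exists_real_btwn.1 hfx
  rw [EReal.coe_lt_coe_iff] at hax
  obtain ⟨M, hM⟩ := hK.exists_bound_of_continuousOn hh.1.continuous.continuousOn
  have hfK : ∀ y ∈ K, f y ≤ a := fun y hy =>
    EReal.coe_le_coe_iff.1 ((le_iSup₂ (f := fun y (_ : y ∈ K) => (f y : EReal)) y hy).trans hKa.le)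
  -- Small enough that `F x` exceeds `a + ε |M|`, a bound for `F` on `K`. The `+ 1` keeps the
  -- denominator positive.
  obtain ⟨ε, hε, hεM⟩ : ∃ ε : ℝ, 0 < ε ∧ ε * (|M| + |h x| + 1) < f x - a :=
    ⟨(f x - a) / (2 * (|M| + |h x| + 1)), by
      have : 0 < f x - a := sub_pos.2 hax
      positivity, by
      have h1 : 0 < |M| + |h x| + 1 := by positivity
      have h2 : 0 < f x - a := sub_pos.2 hax
      have h3 : (f x - a) / (2 * (|M| + |h x| + 1)) * (|M| + |h x| + 1) = (f x - a) / 2 := by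
        field_simp
      linarith⟩
  set F : X → ℝ := f + ε • h with hF
  have hFP : F ∈ φ.PSH := add_smul_mem_PSH hf hh hε.le
  have hFs : φ.IsStrictAt F x := hhx.add_smul hf hh hε
  obtain ⟨c, hac, hcx⟩ : ∃ c, a + ε * |M| < c ∧ c < F x := by
    refine exists_between ?_
    change a + ε * |M| < f x + ε * h x
    nlinarith [neg_abs_le (h x)]
  -- `F` is itself plurisubharmonic, so its bound on `K` extends to the hull.
  have hhull : ∀ y ∈ φ.hull K, F y < c := by
    intro y hy
    have h1 : (F y : EReal) ≤ ((a + ε * |M| : ℝ) : EReal) := by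
      refine (hy F hFP).trans (iSup₂_le fun z hz => EReal.coe_le_coe_iff.2 ?_)
      have h2 : h z ≤ |M| := (le_abs_self _).trans ((hM z hz).trans (le_abs_self M))
      exact add_le_add (hfK z hz) (mul_le_mul_of_nonneg_left h2 hε.le)
    exact (EReal.coe_le_coe_iff.1 h1).trans_lt hac
  obtain ⟨χ, hχ, hχ0, hχc, hχ1, hχ1', hχ2⟩ := exists_contDiff_convex_cutoff c
  refine ⟨χ ∘ F, ⟨hχ.contMDiff.comp hFP.1, fun y v hv => ?_⟩, fun y => hχ0 _, fun v hv => ?_, ?_⟩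
  · rw [φ.ddPhi_real_comp_apply hχ hFP.1 hv]
    exact add_nonneg (mul_nonneg (hχ1 _) (hFP.2 y v hv))
      (mul_nonneg (hχ2 _) (Finset.sum_nonneg fun i _ => sq_nonneg _))
  · rw [φ.ddPhi_real_comp_apply hχ hFP.1 hv]
    exact add_pos_of_pos_of_nonneg (mul_pos (hχ1' _ hcx) (hFs v hv))
      (mul_nonneg (hχ2 _) (Finset.sum_nonneg fun i _ => sq_nonneg _))
  -- The closed set `{c ≤ F}` misses the hull because `F < c` is strict there.
  · have hsub : tsupport (χ ∘ F) ⊆ {y | c ≤ F y} :=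
      closure_minimal (fun y hy => (not_le.1 fun hyc => hy (hχc _ hyc)).le)
        (isClosed_le continuous_const hFP.1.continuous)
    exact fun y hy hyK => not_lt.2 (hsub hy) (hhull y hyK)

end Calibration

/-- A positive current with compact support and `∂_φ∂T ≤ 0` on `U` vanishes near each point where
some nonnegative plurisubharmonic function supported in `U` is strict. -/
theorem Current.IsPositive.notMem_supp [T2Space X] [SigmaCompactSpace X]
    {φ : Calibration g (k + 1)} {T : Current E X (k + 1)} (hT : T.IsPositive φ)
    (hTc : IsCompact T.supp) {U : Set X}
    (hU : NonposOn (boundaryPhi φ (boundary T.toLinearMap)) U) {u : X → ℝ} (hu : u ∈ φ.PSH)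
    (hu0 : ∀ y, 0 ≤ u y) (huU : tsupport u ⊆ U) {x : X} (hx : φ.IsStrictAt u x) :
    x ∉ T.supp := by
  obtain ⟨N, hN, hNc, hNα⟩ := φ.exists_nhds_abs_le (β := φ.ddPhi u)
    (dPhi_isSmooth g φ.smooth hu.1).d hx
  -- Two cutoffs are needed: `η₂ u` has compact support, but its `dd^φ` may lose positivity where
  -- `η₂` varies. As `η₂ = 1` near the support of `η₁`, the form `γ` is `η₁ dd^φ u`, positive on
  -- `φ`-planes.
  obtain ⟨η₁, hη₁, hη₁c, hη₁1, hη₁0⟩ := exists_cutoff (E := E) (hTc.union hNc)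
  obtain ⟨η₂, hη₂, hη₂c, hη₂1, hη₂0⟩ := exists_cutoff (E := E) hη₁c.isCompact
  let f : testFunctions E X := ⟨η₂ * u, hη₂.mul hu.1, hη₂c.mul_right⟩
  let β : testForms E X (k + 1) := dTest k (dPhiTest g φ.form φ.smooth f)
  let γ : testForms E X (k + 1) := fsmulTest η₁ hη₁ β
  have hTβ : T.toLinearMap β ≤ 0 :=
    hU f (fun y => mul_nonneg (hη₂0 y) (hu0 y)) ((tsupport_mul_subset_right).trans huU)
  -- `γ` and `β` agree near the support of `T`, where `η₁ = 1`.
  have hTγ : T.toLinearMap γ = T.toLinearMap β := by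
    rw [← sub_eq_zero, ← map_sub]
    refine T.apply_eq_zero_of_disjoint (disjoint_right.2 fun y hy hy' => ?_)
    have h1 : ∀ᶠ z in 𝓝 y, η₁ z = 1 := hη₁1.filter_mono (nhds_le_nhdsSet (mem_union_left N hy))
    obtain ⟨z, hz, hz1⟩ := (mem_closure_iff_frequently.1 hy').and_eventually h1 |>.exists
    refine hz ?_
    change η₁ z • β.1 z - β.1 z = 0
    rw [hz1, one_smul, sub_self]
  have hγ : ∀ y v, γ.1 y v = η₁ y * φ.ddPhi u y v := by
    intro y v
    change η₁ y * φ.ddPhi (η₂ * u) y v = _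
    by_cases hy : y ∈ tsupport η₁
    · rw [φ.ddPhi_congr (f₂ := u)]
      filter_upwards [hη₂1.filter_mono (nhds_le_nhdsSet hy)] with z hz
      simp [hz]
    · rw [image_eq_zero_of_notMem_tsupport hy, zero_mul, zero_mul]
  intro hxT
  obtain ⟨α, hαN, hα⟩ := hxT N hN
  obtain ⟨C, hC⟩ := hNα α.1 α.2.1
  -- `C` may be negative if no plane lies over `N`; `max C 0` makes the bound hold off `N` too,
  -- where `α = 0`.
  have hbound : ∀ y v, φ.IsPlane y v → |α.1 y v| ≤ max C 0 * γ.1 y v := by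
    intro y v hv
    have hpos := hu.2 y v hv
    rw [hγ]
    by_cases hy : y ∈ N
    · rw [(hη₁1.filter_mono (nhds_le_nhdsSet (mem_union_right T.supp hy))).self_of_nhds, one_mul]
      exact (hC y hy v hv).trans (mul_le_mul_of_nonneg_right (le_max_left _ _) hpos)
    · have h0 : |α.1 y v| = 0 := by
        rw [Form.eq_zero_of_notMem_supp fun h => hy (hαN h)]
        simp
      rw [h0]
      exact mul_nonneg (le_max_right _ _) (mul_nonneg (hη₁0 y) hpos)
  -- Positivity is applied to `max C 0 • γ ± α`, which bounds `T(α)` from both sides.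
  have h1 := hT (max C 0 • γ + α) fun y v hv => by
    change 0 ≤ max C 0 * γ.1 y v + α.1 y v
    linarith [neg_abs_le (α.1 y v), hbound y v hv]
  have h2 := hT (max C 0 • γ + (-1 : ℝ) • α) fun y v hv => by
    change 0 ≤ max C 0 * γ.1 y v + -1 * α.1 y v
    linarith [le_abs_self (α.1 y v), hbound y v hv]
  rw [map_add, map_smul, smul_eq_mul] at h1
  rw [map_add, map_smul, map_smul, smul_eq_mul, smul_eq_mul] at h2
  have h3 : max C 0 * T.toLinearMap γ ≤ 0 :=
    mul_nonpos_of_nonneg_of_nonpos (le_max_right _ _) (hTγ.trans_le hTβ)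
  exact hα (le_antisymm (by linarith) (by linarith))

theorem Current.IsPositive.supp_subset_hull_union_core [T2Space X] [SigmaCompactSpace X]
    {φ : Calibration g (k + 1)} {T : Current E X (k + 1)} (hT : T.IsPositive φ)
    (hTc : IsCompact T.supp) {K : Set X} (hK : IsCompact K)
    (hU : NonposOn (boundaryPhi φ (boundary T.toLinearMap)) (φ.hull K)ᶜ) :
    T.supp ⊆ φ.hull K ∪ φ.core := by
  intro x hx
  by_contra hn
  rw [mem_union, not_or] at hn
  obtain ⟨u, hu, hu0, hus, huU⟩ := φ.exists_PSH_tsupport_subset hK hn.1 hn.2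
  exact hT.notMem_supp hTc hU hu hu0 huU hus hx

/-- The empty supremum is `-∞`, so a point of this hull would contradict any `f` in `PSH`. -/
theorem Calibration.hull_empty_subset_core (φ : Calibration g (k + 1)) :
    φ.hull ∅ ⊆ φ.core := by
  intro x hx
  simp only [core, mem_iInter]
  intro f hf
  simpa using hx f hf

end
end CalibratedGeometry

end

theorem lemma6p2 {n k : ℕ} {X : Type*} [TopologicalSpace X] [T2Space X] [SecondCountableTopology X]
    [ChartedSpace (EuclideanSpace ℝ (Fin n)) X]
    [IsManifold 𝓘(ℝ, EuclideanSpace ℝ (Fin n)) ∞ X]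
    (g : Metric (EuclideanSpace ℝ (Fin n)) X)
    (φ : Calibration g (k + 1)) (hφ : φ.IsParallel)
    (T : Current (EuclideanSpace ℝ (Fin n)) X (k + 1))
    (hT : T.IsPositive φ) (hTc : IsCompact T.supp) :
    (∀ K : Set X, IsCompact K →
      NonposOn (boundaryPhi φ (boundary T.toLinearMap)) (φ.hull K)ᶜ →
        T.supp ⊆ φ.hull K ∪ φ.core) ∧
    (NonposOn (boundaryPhi φ (boundary T.toLinearMap)) Set.univ → T.supp ⊆ φ.core) := by
  -- With second countability this gives σ-compactness, needed for smooth cutoffs and partitions of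
  -- unity.
  have : LocallyCompactSpace X := ChartedSpace.locallyCompactSpace (EuclideanSpace ℝ (Fin n)) X
  refine ⟨fun K hK hU => hT.supp_subset_hull_union_core hTc hK hU, fun hU => ?_⟩
  -- The second assertion is the case `K = ∅` of the first.
  exact (hT.supp_subset_hull_union_core hTc isCompact_empty fun f hf _ =>
    hU f hf (subset_univ _)).trans (union_subset φ.hull_empty_subset_core Subset.rfl)
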